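/- Let $\mathbb{C}^+=\{z\in\mathbb{C}:\operatorname{Re} z>0\}$ be the open right half plane and let $\varphi\in H^\infty(\mathbb{C}^+)$, that is, $\varphi$ is a bounded analytic function on $\mathbb{C}^+$. Let $\varphi(it)=\lim_{x\to0^+}\varphi(x+it)$ denote its boundary function on the imaginary axis; this limit exists for almost every $t\in\mathbb{R}$. Let $\alpha\in\mathbb{C}$. Then the following three conditions are equivalent: (1) $\displaystyle\lim_{\theta\to\infty}\frac{1}{2\theta}\int_{-\theta}^{\theta}\varphi(it)\,dt=\alpha$; (2) $\displaystyle\lim_{x\to\infty}\varphi(x+iy)=\alpha$ for some $y\in\mathbb{R}$; (3) $\displaystyle\lim_{x\to\infty}\varphi(x+iy)=\alpha$ for every $y\in\mathbb{R}$. -/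

import Mathlib

open Filter Topology MeasureTheory

/-- The open right half plane `{z : ℂ | 0 < Re z}`. -/
def rightHalfPlane : Set ℂ := {z : ℂ | 0 < z.re}

/-- `φ` belongs to the Hardy space `H^∞` of the right half plane: it is analytic and bounded there.
The values of `φ` outside the open half plane are irrelevant. -/
structure IsHInfty (φ : ℂ → ℂ) : Prop where
  /-- `φ` is holomorphic on the open right half plane. -/
  differentiableOn : DifferentiableOn ℂ φ rightHalfPlane
  /-- `φ` is bounded on the open right half plane. -/
  bounded : ∃ C : ℝ, ∀ z ∈ rightHalfPlane, ‖φ z‖ ≤ C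

/-- The boundary function `t ↦ φ(it)` on the imaginary axis, given by the limit of `φ(x + it)` as
`x → 0+`. It depends only on the values of `φ` in the open half plane; where the limit does not
exist the value is arbitrary. -/
noncomputable def boundaryFunction (φ : ℂ → ℂ) (t : ℝ) : ℂ :=
  limUnder (𝓝[>] (0 : ℝ)) (fun x : ℝ => φ ((x : ℂ) + (t : ℂ) * Complex.I))

/-!
A primitive `Φ` of `φ` is Lipschitz, so that the mean of the boundary function over `[-θ, θ]` is the
difference quotient of `Φ` over the segment from `-iθ` to `iθ`. The blow-ups
`z ↦ (Φ (r z + p) - Φ p) / r` are uniformly Lipschitz, hence their limits along ultrafilters in `r`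
exist and are again Lipschitz primitives, now of limits of `z ↦ φ (r z + p)`. In the limit the
comparison is exact: the difference quotients over all segments from `-iτ` to `iτ` equal `α` if and
only if the derivative is `α` on the positive real axis, by Phragmén–Lindelöf in one direction and
by the identity theorem in the other. Letting `r → 0` also proves Fatou's theorem, since a Lipschitz
function on the imaginary axis is differentiable almost everywhere.
-/

open Complex (I)
open scoped ComplexConjugate NNReal

theorem exists_tendsto_ultrafilter_of_lipschitzWith {X Y ι : Type*} [PseudoMetricSpace X]
    [PseudoMetricSpace Y] [ProperSpace Y] {K : ℝ≥0} {U : Ultrafilter ι} {F : ι → X → Y}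
    {x₀ : X} {y₀ : Y}
    (hF : ∀ᶠ i in U, LipschitzWith K (F i)) (h₀ : ∀ᶠ i in U, F i x₀ = y₀) :
    ∃ f, LipschitzWith K f ∧ ∀ x, Tendsto (fun i => F i x) U (𝓝 (f x)) := by
  have hlim : ∀ x, ∃ y, Tendsto (fun i => F i x) U (𝓝 y) := fun x => by
    have hmem : ∀ᶠ i in U, F i x ∈ Metric.closedBall y₀ (K * dist x x₀) := by
      filter_upwards [hF, h₀] with i hi hi₀
      exact hi₀ ▸ hi.dist_le_mul x x₀
    obtain ⟨y, -, hy⟩ := (isCompact_closedBall y₀ (K * dist x x₀)).ultrafilter_le_nhds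
      (U.map fun i => F i x) (le_principal_iff.2 hmem)
    exact ⟨y, hy⟩
  choose f hf using hlim
  refine ⟨f, LipschitzWith.of_dist_le_mul fun x y => ?_, hf⟩
  exact le_of_tendsto ((hf x).dist (hf y)) (hF.mono fun i hi => hi.dist_le_mul x y)

theorem tendstoLocallyUniformly_of_lipschitzWith {X Y ι : Type*} [PseudoMetricSpace X]
    [PseudoMetricSpace Y] {K : ℝ≥0} {l : Filter ι} {F : ι → X → Y} {f : X → Y}
    (hF : ∀ᶠ i in l, LipschitzWith K (F i)) (hf : LipschitzWith K f)
    (hlim : ∀ x, Tendsto (fun i => F i x) l (𝓝 (f x))) : TendstoLocallyUniformly F f l := by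
  rw [Metric.tendstoLocallyUniformly_iff]
  intro ε hε x
  have hcont : Tendsto (fun y => K * dist y x) (𝓝 x) (𝓝 0) :=
    (continuous_const.mul (continuous_id.dist continuous_const)).tendsto' x 0 (by simp)
  refine ⟨{y | K * dist y x < ε / 3}, hcont.eventually_lt_const (by positivity), ?_⟩
  filter_upwards [hF, Metric.tendsto_nhds.1 (hlim x) (ε / 3) (by positivity)]
    with i hi hix y (hy : K * dist y x < ε / 3)
  have hfy : dist (f y) (f x) ≤ K * dist y x := hf.dist_le_mul y x
  have hFy : dist (F i y) (F i x) ≤ K * dist y x := hi.dist_le_mul y x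
  rw [dist_comm] at hix
  linarith [dist_triangle4_right (f y) (F i y) (f x) (F i x)]

theorem intervalIntegral_eq_sub_of_lipschitzWith {E : Type*} [NormedAddCommGroup E]
    [NormedSpace ℝ E] [CompleteSpace E] {K : ℝ≥0} {f f' : ℝ → E} (hf : LipschitzWith K f)
    (hf' : ∀ᵐ t, HasDerivAt f (f' t) t) (a b : ℝ) : ∫ t in a..b, f' t = f b - f a := by
  have hderiv : deriv f =ᵐ[volume] f' := hf'.mono fun t ht => ht.deriv
  have hbound : ∀ᵐ t, ‖f' t‖ ≤ K := hf'.mono fun t ht => ht.deriv ▸ norm_deriv_le_of_lipschitz hf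
  have hloc : LocallyIntegrable f' :=
    (memLp_top_of_bound ((aestronglyMeasurable_deriv f _).congr hderiv) K hbound).locallyIntegrable
      le_top
  have hint (x y : ℝ) : IntervalIntegrable f' volume x y :=
    intervalIntegrable_iff.2 ((hloc.integrableOn_isCompact isCompact_uIcc).mono_set
      Set.uIoc_subset_uIcc)
  have hF : LipschitzWith K fun x => ∫ t in a..x, f' t := .of_dist_le_mul fun x y => by
    rw [dist_eq_norm, intervalIntegral.integral_interval_sub_left (hint a x) (hint a y),
      Real.dist_eq]
    exact intervalIntegral.norm_integral_le_of_norm_le_const_ae (hbound.mono fun t ht _ => ht)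
  have hdiff : ∀ᵐ t, HasDerivAt (fun x => f x - ∫ s in a..x, f' s) 0 t := by
    filter_upwards [hf', LocallyIntegrable.ae_hasDerivAt_integral hloc] with t ht hFt
    simpa only [sub_self] using ht.fun_sub (hFt a)
  obtain ⟨c, hc⟩ := ((hf.sub hF).lipschitzOnWith
    |>.absolutelyContinuousOnInterval (a := a) (b := b)).const_of_ae_hasDerivAt_zero
      (hdiff.mono fun t ht _ => ht)
  have hconst := (hc b Set.right_mem_uIcc).trans (hc a Set.left_mem_uIcc).symm
  rw [intervalIntegral.integral_same, sub_zero] at hconst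
  rw [← hconst, sub_sub_cancel]

theorem one_mem_rightHalfPlane : 1 ∈ rightHalfPlane :=
  one_pos (α := ℝ)

theorem isOpen_rightHalfPlane : IsOpen rightHalfPlane :=
  isOpen_lt continuous_const Complex.continuous_re

theorem convex_rightHalfPlane : Convex ℝ rightHalfPlane :=
  convex_halfSpace_re_gt 0

theorem isConnected_rightHalfPlane : IsConnected rightHalfPlane :=
  convex_rightHalfPlane.isConnected ⟨1, one_mem_rightHalfPlane⟩

theorem closure_rightHalfPlane : closure rightHalfPlane = {z | 0 ≤ z.re} :=
  Complex.closure_setOfPred_lt_re 0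

/-- `Φ` is a primitive of `φ` on the right half plane which is `K`-Lipschitz. It is taken to be
Lipschitz on all of `ℂ` so that its boundary values need no separate treatment; its values in the
left half plane are irrelevant. -/
structure IsLipschitzPrimitive (K : ℝ≥0) (Φ φ : ℂ → ℂ) : Prop where
  lipschitz : LipschitzWith K Φ
  hasDerivAt : ∀ z ∈ rightHalfPlane, HasDerivAt Φ (φ z) z

theorem IsHInfty.exists_isLipschitzPrimitive {φ : ℂ → ℂ} (hφ : IsHInfty φ) :
    ∃ K Φ, IsLipschitzPrimitive K Φ φ := by
  obtain ⟨C, hC⟩ := hφ.bounded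
  obtain ⟨G, hG⟩ := convex_rightHalfPlane.exists_forall_hasDerivWithinAt hφ.differentiableOn
  have hLip : LipschitzOnWith C.toNNReal G rightHalfPlane :=
    convex_rightHalfPlane.lipschitzOnWith_of_nnnorm_hasDerivWithin_le hG fun z hz =>
      NNReal.coe_le_coe.1 ((hC z hz).trans (Real.le_coe_toNNReal C))
  obtain ⟨Φ, hΦ, hGΦ⟩ := hLip.extend_finite_dimension
  refine ⟨_, Φ, hΦ, fun z hz => ?_⟩
  exact ((hG z hz).congr hGΦ.symm (hGΦ hz).symm).hasDerivAt (isOpen_rightHalfPlane.mem_nhds hz)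

namespace IsLipschitzPrimitive

variable {K L : ℝ≥0} {Φ Ψ φ ψ : ℂ → ℂ}

theorem differentiableOn (h : IsLipschitzPrimitive K Φ φ) : DifferentiableOn ℂ Φ rightHalfPlane :=
  fun z hz => (h.hasDerivAt z hz).differentiableAt.differentiableWithinAt

theorem eqOn_deriv (h : IsLipschitzPrimitive K Φ φ) : Set.EqOn (deriv Φ) φ rightHalfPlane :=
  fun z hz => (h.hasDerivAt z hz).deriv

theorem sub (hΦ : IsLipschitzPrimitive K Φ φ) (hΨ : IsLipschitzPrimitive L Ψ ψ) :
    IsLipschitzPrimitive (K + L) (fun z => Φ z - Ψ z) fun z => φ z - ψ z where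
  lipschitz := hΦ.lipschitz.sub hΨ.lipschitz
  hasDerivAt z hz := (hΦ.hasDerivAt z hz).fun_sub (hΨ.hasDerivAt z hz)

theorem const_mul (hΦ : IsLipschitzPrimitive K Φ φ) (c : ℂ) :
    IsLipschitzPrimitive (‖c‖₊ * K) (fun z => c * Φ z) fun z => c * φ z where
  lipschitz := (lipschitzWith_smul c).comp hΦ.lipschitz
  hasDerivAt z hz := (hΦ.hasDerivAt z hz).const_mul c

theorem const_mul_id (c : ℂ) : IsLipschitzPrimitive ‖c‖₊ (fun z => c * z) fun _ => c where
  lipschitz := lipschitzWith_smul c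
  hasDerivAt _ _ := hasDerivAt_const_mul c

theorem conj_conj (hΦ : IsLipschitzPrimitive K Φ φ) :
    IsLipschitzPrimitive K (fun z => conj (Φ (conj z))) fun z => conj (φ (conj z)) where
  lipschitz := .of_dist_le_mul fun z w => by
    simpa only [Complex.dist_conj_conj] using hΦ.lipschitz.dist_le_mul (conj z) (conj w)
  hasDerivAt z hz := by
    have hz' : 0 < (conj z).re := (Complex.conj_re z).symm ▸ hz
    have hderiv := (hΦ.hasDerivAt _ hz').conj_conj
    rwa [Complex.conj_conj] at hderiv

theorem re_nonpos (h : IsLipschitzPrimitive K Φ φ) (him : ∀ y : ℝ, (Φ (y * I)).re ≤ 0)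
    (hre : ∀ x : ℝ, 0 < x → (Φ x).re ≤ 0) {z : ℂ} (hz : z ∈ rightHalfPlane) : (Φ z).re ≤ 0 := by
  have hnorm {w : ℂ} (hw : (Φ w).re ≤ 0) : ‖Complex.exp (Φ w)‖ ≤ 1 := by
    rwa [Complex.norm_exp, Real.exp_le_one_iff]
  have hgrowth (w : ℂ) :
      ‖Complex.exp (Φ w)‖ ≤ Real.exp ‖Φ 0‖ * ‖Real.exp (K * ‖w‖ ^ (1 : ℝ))‖ := by
    rw [Real.norm_eq_abs, Real.abs_exp, ← Real.exp_add, Real.rpow_one, Complex.norm_exp,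
      Real.exp_le_exp]
    have hw : ‖Φ w - Φ 0‖ ≤ K * ‖w - 0‖ := h.lipschitz.norm_sub_le w 0
    rw [sub_zero] at hw
    linarith [Complex.re_le_norm (Φ w), norm_sub_norm_le (Φ w) (Φ 0)]
  -- Phragmén–Lindelöf for `exp ∘ Φ`, which has growth order one because `Φ` is Lipschitz.
  have hexp : ‖Complex.exp (Φ z)‖ ≤ 1 := by
    refine PhragmenLindelof.right_half_plane_of_bounded_on_real
      (f := fun w => Complex.exp (Φ w)) (z := z)
      ⟨h.differentiableOn.cexp, h.lipschitz.continuous.cexp.continuousOn⟩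
      ⟨1, one_lt_two, K, .of_bound (Real.exp ‖Φ 0‖) (.of_forall hgrowth)⟩ ?_
      (fun y => hnorm (him y)) (le_of_lt hz)
    exact isBoundedUnder_of_eventually_le
      ((eventually_gt_atTop 0).mono fun x hx => hnorm (hre x hx))
  rwa [Complex.norm_exp, Real.exp_le_one_iff] at hexp

theorem eq_zero_of_re_eq_zero (h : IsLipschitzPrimitive K Φ φ)
    (him : ∀ y : ℝ, (Φ (y * I)).re = 0) (hre : ∀ x : ℝ, 0 < x → (Φ x).re = 0) {z : ℂ}
    (hz : z ∈ rightHalfPlane) : φ z = 0 := by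
  have hre_zero : ∀ w ∈ rightHalfPlane, (Φ w).re = 0 := fun w hw => by
    refine le_antisymm (h.re_nonpos (fun y => (him y).le) (fun x hx => (hre x hx).le) hw) ?_
    simpa using (h.const_mul (-1)).re_nonpos (fun y => by simp [him y])
      (fun x hx => by simp [hre x hx]) hw
  obtain ⟨c, hc⟩ := (h.differentiableOn.analyticOnNhd isOpen_rightHalfPlane).eq_const_of_re_eq_const
    hre_zero isOpen_rightHalfPlane isConnected_rightHalfPlane
  have hconst : Φ =ᶠ[𝓝 z] fun _ => c :=
    eventually_of_mem (isOpen_rightHalfPlane.mem_nhds hz) hc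
  exact (h.hasDerivAt z hz).unique ((hasDerivAt_const z c).congr_of_eventuallyEq hconst)

/- `Φ z - conj (Φ (conj z))` is purely imaginary on the imaginary axis by evenness, and on
the positive reals in any case. -/
theorem im_eq_zero_of_even_on_imaginaryAxis (h : IsLipschitzPrimitive K Φ φ)
    (heven : ∀ y : ℝ, Φ (y * I) = Φ (-(y * I))) {x : ℝ} (hx : 0 < x) : (φ x).im = 0 := by
  have hzero := (h.sub h.conj_conj).eq_zero_of_re_eq_zero (z := x)
    (fun y => by simp [← heven]) (fun x _ => by simp) hx
  rw [Complex.conj_ofReal, sub_eq_zero] at hzero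
  exact Complex.conj_eq_iff_im.1 hzero.symm

theorem eq_zero_of_even_on_imaginaryAxis (h : IsLipschitzPrimitive K Φ φ)
    (heven : ∀ y : ℝ, Φ (y * I) = Φ (-(y * I))) {x : ℝ} (hx : 0 < x) : φ x = 0 := by
  have hre : (I * φ x).im = 0 :=
    (h.const_mul I).im_eq_zero_of_even_on_imaginaryAxis (fun y => congrArg (I * ·) (heven y)) hx
  rw [Complex.I_mul_im] at hre
  exact Complex.ext hre (h.im_eq_zero_of_even_on_imaginaryAxis heven hx)

theorem even_on_imaginaryAxis_of_eq_zero (h : IsLipschitzPrimitive K Φ φ)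
    (hφ : ∀ x : ℝ, 0 < x → φ x = 0) (y : ℝ) : Φ (y * I) = Φ (-(y * I)) := by
  have hderiv : Set.EqOn (deriv Φ) 0 rightHalfPlane := by
    refine ((h.differentiableOn.deriv isOpen_rightHalfPlane).analyticOnNhd
      isOpen_rightHalfPlane).eqOn_zero_of_preconnected_of_frequently_eq_zero
      isConnected_rightHalfPlane.isPreconnected one_mem_rightHalfPlane ?_
    have hne : Tendsto ((↑) : ℝ → ℂ) (𝓝[>] 1) (𝓝[≠] 1) :=
      tendsto_nhdsWithin_of_tendsto_nhds_of_eventually_within _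
        ((Complex.continuous_ofReal.tendsto' 1 1 Complex.ofReal_one).mono_left nhdsWithin_le_nhds)
        (eventually_mem_nhdsWithin.mono fun x hx => by simpa using ne_of_gt hx)
    refine hne.frequently (Eventually.frequently ?_)
    filter_upwards [eventually_mem_nhdsWithin] with x hx
    have hx_pos : 0 < x := one_pos.trans hx
    exact (h.eqOn_deriv hx_pos).trans (hφ x hx_pos)
  obtain ⟨c, hc⟩ := isOpen_rightHalfPlane.exists_is_const_of_deriv_eq_zero
    isConnected_rightHalfPlane.isPreconnected h.differentiableOn hderiv
  have hclosure : Set.EqOn Φ (fun _ => c) (closure rightHalfPlane) :=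
    Set.EqOn.closure hc h.lipschitz.continuous continuous_const
  rw [closure_rightHalfPlane] at hclosure
  exact (hclosure (by simp)).trans (hclosure (by simp)).symm

end IsLipschitzPrimitive

/-- The difference quotient of `Φ` over the vertical segment of half-length `r` centred at `p`;
junk value `0` at `r = 0`. -/
noncomputable def verticalSlope (Φ : ℂ → ℂ) (p : ℂ) (r : ℝ) : ℂ :=
  (Φ (r * I + p) - Φ (-(r * I) + p)) / (2 * (r * I))

/-- The blow-up of `Φ` at `p` at scale `r`, which brings the behaviour of `Φ` at distance about `r`
from `p` to unit scale around `0`. -/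
noncomputable def blowUp (Φ : ℂ → ℂ) (p : ℂ) (r : ℝ) (z : ℂ) : ℂ :=
  (Φ (r * z + p) - Φ p) / r

theorem blowUp_zero (Φ : ℂ → ℂ) (p : ℂ) (r : ℝ) : blowUp Φ p r 0 = 0 := by
  simp [blowUp]

theorem verticalSlope_blowUp (Φ : ℂ → ℂ) (p : ℂ) (r s : ℝ) :
    verticalSlope (blowUp Φ p r) 0 s = verticalSlope Φ p (r * s) := by
  simp only [verticalSlope, blowUp, add_zero, mul_neg, Complex.ofReal_mul, mul_assoc]
  rw [← sub_div, sub_sub_sub_cancel_right, div_div]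
  congr 1
  ring

theorem verticalSlope_eq_iff {Φ : ℂ → ℂ} {p α : ℂ} {r : ℝ} (hr : r ≠ 0) :
    verticalSlope Φ p r = α ↔ Φ (r * I + p) - α * (r * I) = Φ (-(r * I) + p) - α * -(r * I) := by
  have hrI : 2 * (r * I) ≠ 0 := by simpa using hr
  rw [verticalSlope, div_eq_iff hrI, sub_eq_sub_iff_sub_eq_sub, mul_left_comm]
  constructor <;> intro h <;> linear_combination h

namespace IsLipschitzPrimitive

variable {K : ℝ≥0} {Φ φ : ℂ → ℂ} {α : ℂ}

theorem forall_verticalSlope_eq_iff (h : IsLipschitzPrimitive K Φ φ) :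
    (∀ r : ℝ, 0 < r → verticalSlope Φ 0 r = α) ↔ ∀ x : ℝ, 0 < x → φ x = α := by
  have hsub := h.sub (const_mul_id α)
  constructor
  · intro hα x hx
    refine sub_eq_zero.1 (hsub.eq_zero_of_even_on_imaginaryAxis (fun y => ?_) hx)
    have hpos {r : ℝ} (hr : 0 < r) := (verticalSlope_eq_iff hr.ne').1 (hα r hr)
    simp only [add_zero] at hpos
    rcases lt_trichotomy y 0 with hy | rfl | hy
    · simpa using (hpos (neg_pos.2 hy)).symm
    · simp
    · exact hpos hy
  · intro hα r hr
    rw [verticalSlope_eq_iff hr.ne', add_zero, add_zero]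
    exact hsub.even_on_imaginaryAxis_of_eq_zero (fun x hx => sub_eq_zero.2 (hα x hx)) r

protected theorem blowUp (h : IsLipschitzPrimitive K Φ φ) {p : ℂ} (hp : 0 ≤ p.re) {r : ℝ}
    (hr : 0 < r) :
    IsLipschitzPrimitive K (blowUp Φ p r) fun z => φ (r * z + p) where
  lipschitz := .of_dist_le_mul fun z w => by
    have hr' : 0 < ‖(r : ℂ)‖ := norm_pos_iff.2 (Complex.ofReal_ne_zero.2 hr.ne')
    rw [dist_eq_norm, dist_eq_norm, blowUp, blowUp, ← sub_div, sub_sub_sub_cancel_right, norm_div,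
      div_le_iff₀ hr', mul_assoc, mul_comm ‖z - w‖, ← norm_mul]
    refine (h.lipschitz.norm_sub_le (r * z + p) (r * w + p)).trans_eq ?_
    rw [add_sub_add_right_eq_sub, mul_sub]
  hasDerivAt z hz := by
    have hmem : r * z + p ∈ rightHalfPlane := by
      change 0 < (r * z + p).re
      rw [Complex.add_re, Complex.re_ofReal_mul]
      exact add_pos_of_pos_of_nonneg (mul_pos hr hz) hp
    have hr' : (r : ℂ) ≠ 0 := Complex.ofReal_ne_zero.2 hr.ne'
    have hderiv := ((h.hasDerivAt _ hmem).comp z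
      ((hasDerivAt_const_mul (r : ℂ)).add_const p)).sub_const (Φ p) |>.div_const (r : ℂ)
    rwa [mul_div_cancel_right₀ _ hr'] at hderiv

theorem exists_tendsto_ultrafilter {ι : Type*} {U : Ultrafilter ι} {F f : ι → ℂ → ℂ}
    (hF : ∀ᶠ i in U, IsLipschitzPrimitive K (F i) (f i)) (h₀ : ∀ᶠ i in U, F i 0 = 0) :
    ∃ Ψ ψ, IsLipschitzPrimitive K Ψ ψ ∧ (∀ z, Tendsto (fun i => F i z) U (𝓝 (Ψ z))) ∧
      ∀ z ∈ rightHalfPlane, Tendsto (fun i => f i z) U (𝓝 (ψ z)) := by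
  have hlip : ∀ᶠ i in U, LipschitzWith K (F i) := hF.mono fun i hi => hi.lipschitz
  obtain ⟨Ψ, hΨ, hlim⟩ := exists_tendsto_ultrafilter_of_lipschitzWith hlip h₀
  have hunif : TendstoLocallyUniformlyOn F Ψ U rightHalfPlane :=
    (tendstoLocallyUniformly_of_lipschitzWith hlip hΨ hlim).tendstoLocallyUniformlyOn
  have hdiffF : ∀ᶠ i in U, DifferentiableOn ℂ (F i) rightHalfPlane :=
    hF.mono fun i hi => hi.differentiableOn
  have hdiff := hunif.differentiableOn hdiffF isOpen_rightHalfPlane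
  refine ⟨Ψ, deriv Ψ, ⟨hΨ, fun z hz => ?_⟩, hlim, fun z hz => ?_⟩
  · exact (hdiff.differentiableAt (isOpen_rightHalfPlane.mem_nhds hz)).hasDerivAt
  · refine ((hunif.deriv hdiffF isOpen_rightHalfPlane).tendsto_at hz).congr' ?_
    exact hF.mono fun i hi => hi.eqOn_deriv hz

variable {l : Filter ℝ} {p : ℂ}

theorem exists_tendsto_blowUp (h : IsLipschitzPrimitive K Φ φ) (hp : 0 ≤ p.re)
    {U : Ultrafilter ℝ} (hU : ∀ᶠ r : ℝ in U, 0 < r) :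
    ∃ Ψ ψ, IsLipschitzPrimitive K Ψ ψ ∧
      (∀ s : ℝ, Tendsto (fun r => verticalSlope Φ p (r * s)) U (𝓝 (verticalSlope Ψ 0 s))) ∧
      ∀ x : ℝ, 0 < x → Tendsto (fun r : ℝ => φ ((r * x : ℝ) + p)) U (𝓝 (ψ x)) := by
  obtain ⟨Ψ, ψ, hΨ, hlim, hlim'⟩ :=
    exists_tendsto_ultrafilter (hU.mono fun r hr => h.blowUp hp hr) (.of_forall (blowUp_zero Φ p))
  refine ⟨Ψ, ψ, hΨ, fun s => ?_, fun x hx => ?_⟩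
  · simp only [← verticalSlope_blowUp]
    exact ((hlim _).sub (hlim _)).div_const _
  · simpa only [Complex.ofReal_mul] using hlim' x hx

/- Both `𝓝[>] 0`, which governs the boundary values, and `atTop` are such scale-invariant `l`. -/
theorem tendsto_iff_tendsto_verticalSlope (h : IsLipschitzPrimitive K Φ φ) (hp : 0 ≤ p.re)
    (hpos : ∀ᶠ r in l, 0 < r) (hscale : ∀ c : ℝ, 0 < c → Tendsto (· * c) l l) :
    Tendsto (fun r : ℝ => φ (r + p)) l (𝓝 α) ↔ Tendsto (verticalSlope Φ p) l (𝓝 α) := by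
  refine ⟨fun hα => (tendsto_iff_ultrafilter _ _ _).2 fun U hU => ?_,
    fun hα => (tendsto_iff_ultrafilter _ _ _).2 fun U hU => ?_⟩
  · obtain ⟨Ψ, ψ, hΨ, hslope, hψ⟩ := h.exists_tendsto_blowUp hp (hU hpos)
    have hψα : ∀ x : ℝ, 0 < x → ψ x = α := fun x hx =>
      tendsto_nhds_unique (hψ x hx) ((hα.comp (hscale x hx)).mono_left hU)
    simpa only [mul_one, hΨ.forall_verticalSlope_eq_iff.2 hψα 1 one_pos] using hslope 1
  · obtain ⟨Ψ, ψ, hΨ, hslope, hψ⟩ := h.exists_tendsto_blowUp hp (hU hpos)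
    have hslopeα : ∀ s : ℝ, 0 < s → verticalSlope Ψ 0 s = α := fun s hs =>
      tendsto_nhds_unique (hslope s) ((hα.comp (hscale s hs)).mono_left hU)
    simpa only [mul_one, hΨ.forall_verticalSlope_eq_iff.1 hslopeα 1 one_pos] using hψ 1 one_pos

end IsLipschitzPrimitive

theorem tendsto_verticalSlope_of_hasDerivAt {Φ : ℂ → ℂ} {d : ℂ} {t : ℝ}
    (h : HasDerivAt (fun s : ℝ => Φ (s * I)) (d * I) t) :
    Tendsto (verticalSlope Φ (t * I)) (𝓝[>] 0) (𝓝 d) := by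
  have hdiff : HasDerivAt (fun r : ℝ => Φ ((t + r : ℝ) * I) - Φ ((t - r : ℝ) * I))
      (d * I - -(d * I)) 0 :=
    (HasDerivAt.comp_const_add t 0 ((add_zero t).symm ▸ h)).fun_sub
      (HasDerivAt.comp_const_sub t 0 ((sub_zero t).symm ▸ h))
  have hlim := hdiff.tendsto_slope_zero_right.div_const (2 * I)
  have hd : (d * I - -(d * I)) / (2 * I) = d := by field_simp; ring
  rw [hd] at hlim
  refine hlim.congr fun r => ?_
  simp only [verticalSlope, zero_add, add_zero, sub_zero, sub_self, Complex.real_smul,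
    Complex.ofReal_inv, Complex.ofReal_add, Complex.ofReal_sub, add_mul, sub_mul]
  rw [add_comm (r * I), neg_add_eq_sub, inv_mul_eq_div, div_div, mul_left_comm]

namespace IsLipschitzPrimitive

variable {K : ℝ≥0} {Φ φ : ℂ → ℂ}

theorem lipschitzWith_imaginaryAxis (h : IsLipschitzPrimitive K Φ φ) :
    LipschitzWith K fun t : ℝ => Φ (t * I) := .of_dist_le_mul fun s t => by
  simpa [dist_eq_norm, ← sub_mul, ← Complex.ofReal_sub] using
    h.lipschitz.dist_le_mul (s * I) (t * I)

theorem ae_tendsto_and_hasDerivAt_boundaryFunction (h : IsLipschitzPrimitive K Φ φ) :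
    ∀ᵐ t : ℝ, Tendsto (fun x : ℝ => φ (x + t * I)) (𝓝[>] 0) (𝓝 (boundaryFunction φ t)) ∧
      HasDerivAt (fun s : ℝ => Φ (s * I)) (boundaryFunction φ t * I) t := by
  filter_upwards [h.lipschitzWith_imaginaryAxis.ae_differentiableAt_real] with t ht
  obtain ⟨d, hd⟩ : ∃ d, HasDerivAt (fun s : ℝ => Φ (s * I)) (d * I) t :=
    ⟨deriv (fun s : ℝ => Φ (s * I)) t / I, by
      rw [div_mul_cancel₀ _ Complex.I_ne_zero]; exact ht.hasDerivAt⟩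
  have hscale (c : ℝ) (hc : 0 < c) : Tendsto (· * c) (𝓝[>] 0) (𝓝[>] 0) := by
    simpa only [mul_comm] using tendsto_iff_comap.2 (comap_mulLeft_nhdsGT_zero hc).ge
  have hlim : Tendsto (fun x : ℝ => φ (x + t * I)) (𝓝[>] 0) (𝓝 d) :=
    (h.tendsto_iff_tendsto_verticalSlope (by simp) eventually_mem_nhdsWithin hscale).2
      (tendsto_verticalSlope_of_hasDerivAt hd)
  have hboundary : boundaryFunction φ t = d := hlim.limUnder_eq
  exact ⟨hboundary ▸ hlim, hboundary ▸ hd⟩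

theorem one_div_mul_integral_boundaryFunction (h : IsLipschitzPrimitive K Φ φ) (r : ℝ) :
    1 / (2 * (r : ℂ)) * ∫ t in -r..r, boundaryFunction φ t = verticalSlope Φ 0 r := by
  have hFTC := intervalIntegral_eq_sub_of_lipschitzWith h.lipschitzWith_imaginaryAxis
    (h.ae_tendsto_and_hasDerivAt_boundaryFunction.mono fun t ht => ht.2) (-r) r
  rw [intervalIntegral.integral_mul_const, ← eq_div_iff Complex.I_ne_zero] at hFTC
  rw [hFTC, verticalSlope, add_zero, add_zero, Complex.ofReal_neg, neg_mul, one_div_mul_eq_div,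
    div_div, mul_comm I, mul_assoc]

theorem tendsto_dist_verticalSlope (h : IsLipschitzPrimitive K Φ φ) (p q : ℂ) :
    Tendsto (fun r => dist (verticalSlope Φ p r) (verticalSlope Φ q r)) atTop (𝓝 0) := by
  have hbound : Tendsto (fun r : ℝ => K * ‖p - q‖ / r) atTop (𝓝 0) :=
    tendsto_const_nhds.div_atTop tendsto_id
  refine squeeze_zero' (.of_forall fun r => dist_nonneg) ?_ hbound
  filter_upwards [eventually_gt_atTop 0] with r hr
  have hshift (z : ℂ) : ‖Φ (z + p) - Φ (z + q)‖ ≤ K * ‖p - q‖ := by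
    simpa using h.lipschitz.norm_sub_le (z + p) (z + q)
  have hnum := (norm_sub_le _ _).trans (add_le_add (hshift (r * I)) (hshift (-(r * I))))
  have hden : ‖2 * (r * I)‖ = 2 * r := by simp [hr.le]
  rw [dist_eq_norm, verticalSlope, verticalSlope, ← sub_div, norm_div, hden, sub_sub_sub_comm,
    div_le_div_iff₀ (by positivity) hr]
  linarith [mul_le_mul_of_nonneg_right hnum hr.le]

end IsLipschitzPrimitive

theorem theorem4p6 (φ : ℂ → ℂ) (hφ : IsHInfty φ) (α : ℂ) :
    -- the boundary function is well defined almost everywhere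
    (∀ᵐ t : ℝ, Tendsto (fun x : ℝ => φ ((x : ℂ) + (t : ℂ) * Complex.I)) (𝓝[>] (0 : ℝ))
      (𝓝 (boundaryFunction φ t))) ∧
    List.TFAE
      [Tendsto (fun θ : ℝ => (1 / (2 * (θ : ℂ))) * ∫ t in (-θ)..θ, boundaryFunction φ t)
          atTop (𝓝 α),
        ∃ y : ℝ, Tendsto (fun x : ℝ => φ ((x : ℂ) + (y : ℂ) * Complex.I)) atTop (𝓝 α),
        ∀ y : ℝ, Tendsto (fun x : ℝ => φ ((x : ℂ) + (y : ℂ) * Complex.I)) atTop (𝓝 α)] := by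
  obtain ⟨K, Φ, hΦ⟩ := hφ.exists_isLipschitzPrimitive
  have hline (y : ℝ) : Tendsto (fun x : ℝ => φ (x + y * Complex.I)) atTop (𝓝 α) ↔
      Tendsto (verticalSlope Φ 0) atTop (𝓝 α) := by
    rw [hΦ.tendsto_iff_tendsto_verticalSlope (by simp) (eventually_gt_atTop 0)
      fun c hc => tendsto_id.atTop_mul_const hc]
    exact tendsto_iff_of_dist (hΦ.tendsto_dist_verticalSlope _ _)
  refine ⟨hΦ.ae_tendsto_and_hasDerivAt_boundaryFunction.mono fun t ht => ht.1, ?_⟩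
  simp only [hΦ.one_div_mul_integral_boundaryFunction, hline, exists_const, forall_const]
  tfae_finish
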